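/- Fix $\sigma>0$. A fair multi-agent multi-armed bandit instance with $n$ agents and $m$ arms consists of $\sigma$-sub-Gaussian reward distributions $D_{i,j}$ ($i\in[n]$, $j\in[m]$) with means $A_{i,j}\in(0,1]$, and fractions $C_1,\dots,C_n\in[0,1]$ such that $\sum_i C_i\le 1$ or $\max_i C_i\le 1/\min(n,m)$. Write $A^\star_i=\max_j A_{i,j}$, let $\Delta_m$ be the set of probability vectors on $[m]$, and let $\mathrm{SW}(p)=\sum_{i}\langle A_i,p\rangle$ for $p\in\Delta_m$. A vector $p\in\Delta_m$ is fair if $\langle A_i,p\rangle\ge C_iA^\star_i$ for all $i$, and $\pi^*$ denotes a fair vector of maximal $\mathrm{SW}$. An algorithm knows $n,m,\sigma,T$ and $C$ but not the distributions $D_{i,j}$; in each round $t=1,\dots,T$ it chooses, as a measurable function of the past pulls and the observed rewards, a vector $\pi^t\in\Delta_m$, an arm $j$ is drawn from $\pi^t$, and independent rewards $X_i^t\sim D_{i,j}$ of all agents $i\in[n]$ are observed. Its expected social welfare regret and expected fairness regret are $$\mathcal R_{\mathrm{SW}}(T)=\mathbb E\Big[T\,\mathrm{SW}(\pi^*)-\sum_{t=1}^T\mathrm{SW}(\pi^t)\Big],\qquad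 \mathcal R_{\mathrm{FR}}(T)=\mathbb E\Big[\sum_{t=1}^T\sum_{i=1}^n\max\{C_iA^\star_i-\langle A_i,\pi^t\rangle,\,0\}\Big].$$ Theorem. For every $\sigma>0$ there is a constant $c>0$, depending only on $\sigma$, such that for all $n\ge1$, $m\ge2$, every algorithm and every horizon $T\ge1$: there is an instance, admitting a fair vector, on which $\mathcal R_{\mathrm{SW}}(T)\ge c\sqrt T$; and there is an instance (not necessarily the same one), admitting a fair vector, on which $\mathcal R_{\mathrm{FR}}(T)\ge c\sqrt T$. -/

import Mathlib

open MeasureTheory ProbabilityTheory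
open scoped NNReal

noncomputable section

namespace FairBandit

/-- What is observed in one round: the arm that was pulled, and the vector of the rewards that
the `n` agents received from it. -/
abbrev Obs (n m : ℕ) : Type := Fin m × (Fin n → ℝ)

/-- The history of the first `t` rounds: past pulls and observed rewards. -/
abbrev History (n m t : ℕ) : Type := Fin t → Obs n m

/-- An arm-pull strategy `(πᵗ)`: after `t` completed rounds the history is mapped (measurably)
to a probability vector over the arms, from which the next arm is drawn. -/
structure Policy (n m : ℕ) where
  prob : (t : ℕ) → History n m t → Fin m → ℝ
  prob_mem : ∀ t h, prob t h ∈ stdSimplex ℝ (Fin m)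
  measurable_prob : ∀ t, Measurable (prob t)

/-- A learning algorithm is given the horizon `T` and the fairness fractions `C`, and plays an
arm-pull strategy. It is not given the mean rewards or the reward distributions. -/
abbrev Algorithm (n m : ℕ) : Type := (T : ℕ) → (C : Fin n → ℝ) → Policy n m

/-- A multi-agent bandit instance with `n` agents, `m` arms and `σ`-sub-Gaussian rewards:
`D i j` is the reward distribution of agent `i` for arm `j`, with mean in `(0, 1]`, and
`C i ∈ [0, 1]` is the fraction of its maximum expected reward promised to agent `i`. -/
structure Instance (n m : ℕ) (σ : ℝ≥0) where
  D : Fin n → Fin m → Measure ℝ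
  isProb : ∀ i j, IsProbabilityMeasure (D i j)
  subGaussian : ∀ i j, HasSubgaussianMGF (fun x => x - ∫ y, y ∂(D i j)) (σ ^ 2) (D i j)
  mean_mem : ∀ i j, ∫ x, x ∂(D i j) ∈ Set.Ioc (0 : ℝ) 1
  C : Fin n → ℝ
  C_mem : ∀ i, C i ∈ Set.Icc (0 : ℝ) 1

namespace Instance

variable {n m : ℕ} {σ : ℝ≥0}

/-- The matrix of mean rewards. -/
def A (I : Instance n m σ) (i : Fin n) (j : Fin m) : ℝ := ∫ x, x ∂(I.D i j)

/-- The maximum expected reward of agent `i`. -/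
def Astar (I : Instance n m σ) (i : Fin n) : ℝ := ⨆ j, I.A i j

/-- Expected reward `⟨A_i, p⟩` of agent `i` when the arm is drawn from `p`. -/
def reward (I : Instance n m σ) (i : Fin n) (p : Fin m → ℝ) : ℝ := ∑ j, I.A i j * p j

/-- Expected social welfare of one round in which the arm is drawn from `p`. -/
def SW (I : Instance n m σ) (p : Fin m → ℝ) : ℝ := ∑ i, I.reward i p

/-- `p` is a probability vector that satisfies the minimum reward fairness guarantee. -/
def IsFair (I : Instance n m σ) (p : Fin m → ℝ) : Prop :=
  p ∈ stdSimplex ℝ (Fin m) ∧ ∀ i, I.C i * I.Astar i ≤ I.reward i p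

/-- `p` maximizes social welfare among the fair policies. -/
def IsOptimalFair (I : Instance n m σ) (p : Fin m → ℝ) : Prop :=
  I.IsFair p ∧ ∀ q, I.IsFair q → I.SW q ≤ I.SW p

/-- The standing condition on the fairness fractions:
`∑ C_i ≤ 1` or `max C_i ≤ 1 / min (n, m)`. -/
def FairnessCondition (I : Instance n m σ) : Prop :=
  ∑ i, I.C i ≤ 1 ∨ ∀ i, I.C i ≤ 1 / ((min n m : ℕ) : ℝ)

/-- The law of the reward vector when arm `j` is pulled; the agents' rewards are independent. -/
def rewardLaw (I : Instance n m σ) (j : Fin m) : Measure (Fin n → ℝ) :=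
  Measure.pi fun i => I.D i j

/-- The law of the history of the first `t` rounds when `π` is played on `I`: given the history
`h` of the first `t` rounds, arm `j` is pulled with probability `π.prob t h j`, and a fresh
reward vector is then drawn from `I.rewardLaw j`. -/
def historyLaw (I : Instance n m σ) (π : Policy n m) : (t : ℕ) → Measure (History n m t)
  | 0 => Measure.dirac Fin.elim0
  | t + 1 => ∑ j : Fin m,
      (((I.historyLaw π t).withDensity fun h => ENNReal.ofReal (π.prob t h j)).prod
        (I.rewardLaw j)).map
          fun q => (Fin.snoc q.1 ((j, q.2) : Obs n m) : History n m (t + 1))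

/-- The distribution over arms that `π` uses in round `t` (rounds are numbered `0, …, T - 1`),
as a function of the history of all `T` rounds, of which it uses only the past. -/
def roundPolicy (π : Policy n m) {T : ℕ} (h : History n m T) (t : Fin T) : Fin m → ℝ :=
  π.prob t fun s => h (Fin.castLE t.isLt.le s)

/-- Expected social welfare regret over `T` rounds, relative to the optimal fair policy
`pstar`: the expectation of `T * SW(pstar) - ∑ SW(πᵗ)`. -/
def swRegret (I : Instance n m σ) (pstar : Fin m → ℝ) (π : Policy n m) (T : ℕ) : ℝ :=
  ∫ h : History n m T, (T * I.SW pstar - ∑ t : Fin T, I.SW (roundPolicy π h t))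
    ∂(I.historyLaw π T)

/-- Expected minimum-reward fairness regret over `T` rounds: the expectation of
`∑_t ∑_i max (C_i * Astar_i - ⟨A_i, πᵗ⟩) 0`. -/
def fairnessRegret (I : Instance n m σ) (π : Policy n m) (T : ℕ) : ℝ :=
  ∫ h : History n m T,
    (∑ t : Fin T, ∑ i, max (I.C i * I.Astar i - I.reward i (roundPolicy π h t)) 0)
    ∂(I.historyLaw π T)

end Instance

end FairBandit

end

/-! Le Cam's two-point method. Promising agent `0` its full maximum and the others nothing makes
every fair vector optimal for agent `0`. The other agents have the same mean on every arm, so both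
regrets of a round equal the same number, `hardGap`. With `d` of order `1 / √T`, take the two
Gaussian instances `δ = d` and `δ = -d`: a round costs `d` times the mass on arm `0` in the first
and `d` times the remaining mass in the second.

The instances cannot be told apart. One round has likelihood-ratio second moment at most `exp ((2d)²
/ σ²)`; by `sqDominated_historyLaw` these factors multiply, and their `T`-th power is at most `2`.
If `a` and `b` are the expected fractions of mass on arm `0` under `d` and `-d`, then `b² ≤ 2a` by
`SqDominated.sq_integral_le`. So `a` and `1 - b` are not both small, and one instance has regret of
order `T d`, that is `√T`. -/

open scoped ENNReal

noncomputable section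

namespace FairBandit

/-! ### Second-moment comparison of measures -/

/-- The bound `(∫ f dμ)² ≤ K ∫ f² dν` for all measurable `f ≥ 0`, which says that
`μ` has a density with respect to `ν` whose second moment is at most `K`. -/
def SqDominated {α : Type*} [MeasurableSpace α] (μ ν : Measure α) (K : ℝ≥0∞) : Prop :=
  ∀ f : α → ℝ≥0∞, Measurable f → (∫⁻ x, f x ∂μ) ^ 2 ≤ K * ∫⁻ x, f x ^ 2 ∂ν

lemma sq_lintegral_mul_le {α : Type*} [MeasurableSpace α] (μ : Measure α) {f g : α → ℝ≥0∞}
    (hf : Measurable f) (hg : Measurable g) :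
    (∫⁻ x, f x * g x ∂μ) ^ 2 ≤ (∫⁻ x, f x ^ 2 ∂μ) * ∫⁻ x, g x ^ 2 ∂μ := by
  have h := ENNReal.lintegral_mul_le_Lp_mul_Lq μ Real.HolderConjugate.two_two
    hf.aemeasurable hg.aemeasurable
  simp only [Pi.mul_apply, ENNReal.rpow_two] at h
  refine (pow_le_pow_left' h 2).trans_eq ?_
  rw [mul_pow, ← ENNReal.rpow_two, ← ENNReal.rpow_two, ← ENNReal.rpow_mul, ← ENNReal.rpow_mul]
  norm_num

namespace SqDominated

variable {α β : Type*} [MeasurableSpace α] [MeasurableSpace β]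

lemma mono {μ ν : Measure α} {K K' : ℝ≥0∞} (h : SqDominated μ ν K) (hK : K ≤ K') :
    SqDominated μ ν K' := fun f hf => (h f hf).trans (by gcongr)

lemma refl (μ : Measure α) [IsProbabilityMeasure μ] : SqDominated μ μ 1 := fun f hf => by
  simpa [mul_comm] using sq_lintegral_mul_le μ hf (measurable_const (a := (1 : ℝ≥0∞)))

lemma prod {μ ν : Measure α} {μ' ν' : Measure β} [SFinite μ'] [SFinite ν']
    {K K' : ℝ≥0∞} (h : SqDominated μ ν K) (h' : SqDominated μ' ν' K') :
    SqDominated (μ.prod μ') (ν.prod ν') (K * K') := fun f hf => by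
  rw [lintegral_prod _ hf.aemeasurable, lintegral_prod _ (hf.pow_const 2).aemeasurable]
  refine (h _ hf.lintegral_prod_right').trans ?_
  rw [mul_assoc, ← lintegral_const_mul _ (hf.pow_const 2).lintegral_prod_right']
  gcongr with x
  exact h' _ (hf.comp measurable_prodMk_left)

lemma of_measurePreserving {μ ν : Measure α} {μ' ν' : Measure β} {K : ℝ≥0∞} (e : α ≃ᵐ β)
    (hμ : MeasurePreserving e μ μ') (hν : MeasurePreserving e ν ν') (h : SqDominated μ' ν' K) :
    SqDominated μ ν K := fun f hf => by
  have hg : Measurable fun y => f (e.symm y) := hf.comp e.symm.measurable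
  have := h _ hg
  rw [← hμ.lintegral_comp hg, ← hν.lintegral_comp (hg.pow_const 2)] at this
  simpa using this

/-- Completing the square gives `φ_a² / φ_b = exp ((a - b)² / v) φ_{2a - b}` for the densities,
whose integral is the constant. Cauchy–Schwarz for `φ_a f = (φ_a / √φ_b) (√φ_b f)` does the rest. -/
lemma gaussianReal (a b : ℝ) {v : ℝ≥0} (hv : v ≠ 0) :
    SqDominated (gaussianReal a v) (gaussianReal b v)
      (ENNReal.ofReal (Real.exp ((a - b) ^ 2 / v))) := fun f hf => by
  have hv' : (v : ℝ) ≠ 0 := by exact_mod_cast hv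
  rw [gaussianReal_of_var_ne_zero _ hv, gaussianReal_of_var_ne_zero _ hv,
    lintegral_withDensity_eq_lintegral_mul _ (measurable_gaussianPDF _ _) hf,
    lintegral_withDensity_eq_lintegral_mul _ (measurable_gaussianPDF _ _) (hf.pow_const 2)]
  set u : ℝ → ℝ≥0∞ := fun x => ENNReal.ofReal √(gaussianPDFReal b v x)
  set w : ℝ → ℝ≥0∞ := fun x =>
    ENNReal.ofReal (gaussianPDFReal a v x / √(gaussianPDFReal b v x))
  have hu : Measurable u := (measurable_gaussianPDFReal b v).sqrt.ennreal_ofReal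
  have hw : Measurable w :=
    ((measurable_gaussianPDFReal a v).div (measurable_gaussianPDFReal b v).sqrt).ennreal_ofReal
  have hpos := fun c x => gaussianPDFReal_pos c v x hv
  have huw : ∀ x, gaussianPDF a v x = u x * w x := fun x => by
    simp only [u, w, gaussianPDF]
    rw [← ENNReal.ofReal_mul (Real.sqrt_nonneg _),
      mul_div_cancel₀ _ (Real.sqrt_pos.2 (hpos b x)).ne']
  have huu : ∀ x, gaussianPDF b v x = u x ^ 2 := fun x => by
    simp only [u, gaussianPDF]
    rw [← ENNReal.ofReal_pow (Real.sqrt_nonneg _), Real.sq_sqrt (hpos b x).le]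
  have hww : ∀ x, w x ^ 2 = ENNReal.ofReal (Real.exp ((a - b) ^ 2 / v)) *
      gaussianPDF (2 * a - b) v x := fun x => by
    simp only [w, gaussianPDF]
    rw [← ENNReal.ofReal_pow (div_nonneg (hpos a x).le (Real.sqrt_nonneg _)),
      ← ENNReal.ofReal_mul (Real.exp_nonneg _), div_pow, Real.sq_sqrt (hpos b x).le]
    congr 1
    rw [div_eq_iff (hpos b x).ne']
    simp only [gaussianPDFReal]
    have hexp : Real.exp (-(x - a) ^ 2 / (2 * v)) ^ 2 = Real.exp ((a - b) ^ 2 / v) *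
        Real.exp (-(x - (2 * a - b)) ^ 2 / (2 * v)) * Real.exp (-(x - b) ^ 2 / (2 * v)) := by
      rw [← Real.exp_nat_mul, ← Real.exp_add, ← Real.exp_add]
      congr 1
      push_cast
      field_simp
      ring
    rw [mul_pow, hexp]
    ring
  have hw1 : ∫⁻ x, w x ^ 2 = ENNReal.ofReal (Real.exp ((a - b) ^ 2 / v)) := by
    simp_rw [hww]
    rw [lintegral_const_mul _ (measurable_gaussianPDF _ _), lintegral_gaussianPDF_eq_one _ hv,
      mul_one]
  calc (∫⁻ x, (gaussianPDF a v * f) x) ^ 2 = (∫⁻ x, w x * (u x * f x)) ^ 2 := by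
        congr 2
        ext x
        rw [Pi.mul_apply, huw]
        ring
    _ ≤ _ := sq_lintegral_mul_le _ hw (hu.mul hf)
    _ = _ := by
        rw [hw1]
        congr 2
        ext x
        rw [Pi.mul_apply, huu, mul_pow]

end SqDominated

lemma hasSubgaussianMGF_gaussianReal (a : ℝ) (v : ℝ≥0) :
    HasSubgaussianMGF (fun x => x - ∫ y, y ∂(gaussianReal a v)) v (gaussianReal a v) := by
  rw [integral_id_gaussianReal]
  constructor
  · intro t
    have := (integrable_exp_mul_gaussianReal (μ := a) (v := v) t).mul_const (Real.exp (-(t * a)))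
    refine this.congr (ae_of_all _ fun x => ?_)
    simp only
    rw [← Real.exp_add]
    ring_nf
  · intro t
    rw [mgf_gaussianReal (gaussianReal_map_sub_const a)]
    simp

/-! ### Laws of histories -/

variable {n m : ℕ} {σ : ℝ≥0}

lemma measurable_snoc (t : ℕ) (j : Fin m) :
    Measurable fun q : History n m t × (Fin n → ℝ) =>
      (Fin.snoc q.1 ((j, q.2) : Obs n m) : History n m (t + 1)) := by
  rw [measurable_pi_iff]
  intro s
  induction s using Fin.lastCases with
  | last => simp only [Fin.snoc_last]; fun_prop
  | cast s => simp only [Fin.snoc_castSucc]; fun_prop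

namespace Instance

instance (I : Instance n m σ) (j : Fin m) : IsProbabilityMeasure (I.rewardLaw j) := by
  have := fun i => I.isProb i j
  unfold rewardLaw
  infer_instance

lemma measurable_prob_apply (π : Policy n m) (t : ℕ) (j : Fin m) :
    Measurable fun h => ENNReal.ofReal (π.prob t h j) :=
  ((measurable_pi_apply j).comp (π.measurable_prob t)).ennreal_ofReal

lemma sum_ofReal_prob (π : Policy n m) (t : ℕ) (h : History n m t) :
    ∑ j, ENNReal.ofReal (π.prob t h j) = 1 := by
  rw [← ENNReal.ofReal_sum_of_nonneg fun j _ => (π.prob_mem t h).1 j, (π.prob_mem t h).2,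
    ENNReal.ofReal_one]

lemma lintegral_historyLaw_succ (I : Instance n m σ) (π : Policy n m) (t : ℕ)
    [SFinite (I.historyLaw π t)] {f : History n m (t + 1) → ℝ≥0∞} (hf : Measurable f) :
    ∫⁻ h, f h ∂(I.historyLaw π (t + 1)) =
      ∫⁻ h, ∑ j, ENNReal.ofReal (π.prob t h j) *
        ∫⁻ x, f (Fin.snoc h ((j, x) : Obs n m)) ∂(I.rewardLaw j) ∂(I.historyLaw π t) := by
  have hfs : ∀ j, Measurable fun q : History n m t × (Fin n → ℝ) =>
      f (Fin.snoc q.1 ((j, q.2) : Obs n m)) := fun j => hf.comp (measurable_snoc t j)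
  rw [historyLaw, lintegral_finsetSum_measure, lintegral_finsetSum]
  · refine Finset.sum_congr rfl fun j _ => ?_
    rw [lintegral_map hf (measurable_snoc t j), lintegral_prod _ (hfs j).aemeasurable,
      lintegral_withDensity_eq_lintegral_mul _ (measurable_prob_apply π t j)
        (hfs j).lintegral_prod_right']
    rfl
  · exact fun j _ => (measurable_prob_apply π t j).mul (hfs j).lintegral_prod_right'

instance isProbabilityMeasure_historyLaw (I : Instance n m σ) (π : Policy n m) :
    ∀ t, IsProbabilityMeasure (I.historyLaw π t)
  | 0 => by unfold historyLaw; infer_instance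
  | t + 1 => by
    have := isProbabilityMeasure_historyLaw I π t
    constructor
    rw [← lintegral_one, lintegral_historyLaw_succ I π t measurable_const]
    simp [sum_ofReal_prob]

/-- A one-round second moment bound between two instances propagates to the histories. -/
lemma sqDominated_historyLaw (I J : Instance n m σ) (π : Policy n m) {K : ℝ≥0∞}
    (hK : ∀ j, SqDominated (I.rewardLaw j) (J.rewardLaw j) K) :
    ∀ t, SqDominated (I.historyLaw π t) (J.historyLaw π t) (K ^ t)
  | 0 => by simpa only [historyLaw, pow_zero] using SqDominated.refl _
  | t + 1 => fun f hf => by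
    have hfs : ∀ j, Measurable fun q : History n m t × (Fin n → ℝ) =>
      f (Fin.snoc q.1 ((j, q.2) : Obs n m)) := fun j => hf.comp (measurable_snoc t j)
    rw [lintegral_historyLaw_succ I π t hf, lintegral_historyLaw_succ J π t (hf.pow_const 2)]
    refine (sqDominated_historyLaw I J π hK t _ ?_).trans ?_
    · exact Finset.measurable_fun_sum _ fun j _ =>
        (measurable_prob_apply π t j).mul (hfs j).lintegral_prod_right'
    rw [pow_succ, mul_assoc, ← lintegral_const_mul (μ := J.historyLaw π t) K]
    · gcongr with h
      -- The policy's arm weights given `h` are the same under both instances, so convexity of the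
      -- square moves it inside the average over arms at no cost in `K`.
      have := ENNReal.rpow_arith_mean_le_arith_mean_rpow Finset.univ
        (fun j => ENNReal.ofReal (π.prob t h j))
        (fun j => ∫⁻ x, f (Fin.snoc h ((j, x) : Obs n m)) ∂(I.rewardLaw j))
        (sum_ofReal_prob π t h) one_le_two
      simp only [ENNReal.rpow_two] at this
      refine this.trans ?_
      rw [Finset.mul_sum]
      refine Finset.sum_le_sum fun j _ => ?_
      rw [mul_left_comm]
      gcongr
      exact hK j _ ((hfs j).comp measurable_prodMk_left)
    · exact Finset.measurable_fun_sum _ fun j _ =>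
        (measurable_prob_apply π t j).mul ((hfs j).pow_const 2).lintegral_prod_right'

end Instance

/-- Values in `[0, 1]` satisfy `f² ≤ f`, so the second moment under `ν` may be replaced by the mean.
-/
lemma SqDominated.sq_integral_le {α : Type*} [MeasurableSpace α] {μ ν : Measure α}
    [IsProbabilityMeasure μ] [IsProbabilityMeasure ν] {K : ℝ} (hK : 0 ≤ K)
    (h : SqDominated μ ν (ENNReal.ofReal K)) {f : α → ℝ} (hf : Measurable f)
    (h01 : ∀ x, f x ∈ Set.Icc (0 : ℝ) 1) :
    (∫ x, f x ∂μ) ^ 2 ≤ K * ∫ x, f x ∂ν := by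
  have hint : ∀ (ρ : Measure α) [IsProbabilityMeasure ρ], Integrable f ρ := fun ρ _ =>
    Integrable.of_mem_Icc 0 1 hf.aemeasurable (ae_of_all _ h01)
  have hnn := fun x => (h01 x).1
  have key := h _ hf.ennreal_ofReal
  have hle : ∫⁻ x, ENNReal.ofReal (f x) ^ 2 ∂ν ≤ ∫⁻ x, ENNReal.ofReal (f x) ∂ν := by
    gcongr with x
    rw [← ENNReal.ofReal_pow (hnn x)]
    exact ENNReal.ofReal_le_ofReal (pow_le_of_le_one (hnn x) (h01 x).2 two_ne_zero)
  have key2 := key.trans (mul_le_mul_right hle _)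
  rw [← ofReal_integral_eq_lintegral_ofReal (hint μ) (ae_of_all _ hnn),
    ← ofReal_integral_eq_lintegral_ofReal (hint ν) (ae_of_all _ hnn),
    ← ENNReal.ofReal_pow (integral_nonneg hnn), ← ENNReal.ofReal_mul hK] at key2
  exact (ENNReal.ofReal_le_ofReal_iff (mul_nonneg hK (integral_nonneg hnn))).1 key2

/-! ### The hard instances -/

/-- All mean rewards are `1 / 2`, except that agent `0` gets `1 / 2 + δ` from every arm but
arm `0`. -/
def hardMean {k l : ℕ} (δ : ℝ) (i : Fin (k + 1)) (j : Fin (l + 2)) : ℝ :=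
  1 / 2 + if i = 0 ∧ j ≠ 0 then δ else 0

/-- Gaussian rewards with means `hardMean δ`; agent `0` is promised its maximal reward, the other
agents nothing. -/
def hardInstance (k l : ℕ) (σ : ℝ≥0) (δ : ℝ) (hδ : |δ| ≤ 1 / 4) :
    Instance (k + 1) (l + 2) σ where
  D i j := gaussianReal (hardMean δ i j) (σ ^ 2)
  isProb _ _ := inferInstance
  subGaussian _ _ := hasSubgaussianMGF_gaussianReal _ _
  mean_mem i j := by
    rw [integral_id_gaussianReal, hardMean]
    have := abs_le.1 hδ
    split_ifs <;> constructor <;> linarith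
  C := Pi.single 0 1
  C_mem i := by
    by_cases h : i = 0
    · subst h; simp
    · simp [h]

section hardInstance

variable {k l : ℕ} {δ : ℝ} (hδ : |δ| ≤ 1 / 4)

lemma hardInstance_A (i : Fin (k + 1)) (j : Fin (l + 2)) :
    (hardInstance k l σ δ hδ).A i j = hardMean δ i j := integral_id_gaussianReal

lemma hardInstance_C_zero : (hardInstance k l σ δ hδ).C 0 = 1 := by
  simp [hardInstance]

lemma hardInstance_C_of_ne {i : Fin (k + 1)} (hi : i ≠ 0) :
    (hardInstance k l σ δ hδ).C i = 0 := Pi.single_eq_of_ne hi _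

lemma hardInstance_fairnessCondition : (hardInstance k l σ δ hδ).FairnessCondition :=
  Or.inl (Finset.sum_pi_single' (0 : Fin (k + 1)) (1 : ℝ) Finset.univ |>.trans (by simp)).le

lemma hardInstance_Astar_zero : (hardInstance k l σ δ hδ).Astar 0 = 1 / 2 + max δ 0 := by
  simp only [Instance.Astar, hardInstance_A]
  refine le_antisymm (ciSup_le fun j => ?_) ?_
  · simp only [hardMean]
    gcongr
    split_ifs
    · exact le_max_left _ _
    · exact le_max_right _ _
  · have hb := Set.finite_range (hardMean (k := k) (l := l) δ 0) |>.bddAbove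
    rcases max_choice δ 0 with h | h <;> rw [h]
    · exact le_trans (by simp [hardMean]) (le_ciSup hb 1)
    · exact le_trans (by simp [hardMean]) (le_ciSup hb 0)

lemma hardInstance_reward_zero {p : Fin (l + 2) → ℝ} (hp : p ∈ stdSimplex ℝ (Fin (l + 2))) :
    (hardInstance k l σ δ hδ).reward 0 p = 1 / 2 + δ * (1 - p 0) := by
  have h := hp.2
  rw [Fin.sum_univ_succ] at h
  simp only [Instance.reward, hardInstance_A, hardMean, Fin.sum_univ_succ (n := l + 1)]
  simp [← Finset.mul_sum]
  linear_combination (1 / 2 + δ) * h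

lemma hardInstance_reward_of_ne {p : Fin (l + 2) → ℝ} (hp : p ∈ stdSimplex ℝ (Fin (l + 2)))
    {i : Fin (k + 1)} (hi : i ≠ 0) :
    (hardInstance k l σ δ hδ).reward i p = 1 / 2 := by
  simp [Instance.reward, hardInstance_A, hardMean, hi, ← Finset.mul_sum, hp.2]

lemma hardInstance_SW {p : Fin (l + 2) → ℝ} (hp : p ∈ stdSimplex ℝ (Fin (l + 2))) :
    (hardInstance k l σ δ hδ).SW p = (k + 1) / 2 + δ * (1 - p 0) := by
  rw [Instance.SW, Fin.sum_univ_succ, hardInstance_reward_zero hδ hp]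
  simp only [hardInstance_reward_of_ne hδ hp (Fin.succ_ne_zero _)]
  simp
  ring

/-- The regret of one round in which the arm is drawn from `p`. -/
def hardGap (δ : ℝ) (p : Fin (l + 2) → ℝ) : ℝ := max δ 0 - δ * (1 - p 0)

lemma apply_mem_Icc {p : Fin (l + 2) → ℝ} (hp : p ∈ stdSimplex ℝ (Fin (l + 2)))
    (j : Fin (l + 2)) : p j ∈ Set.Icc (0 : ℝ) 1 :=
  mem_Icc_of_mem_stdSimplex hp j

lemma hardGap_nonneg {p : Fin (l + 2) → ℝ} (hp : p ∈ stdSimplex ℝ (Fin (l + 2))) :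
    0 ≤ hardGap δ p := by
  have h0 := apply_mem_Icc hp 0
  rw [hardGap, sub_nonneg]
  rcases le_total δ 0 with h | h
  · exact (mul_nonpos_of_nonpos_of_nonneg h (by linarith [h0.2])).trans (le_max_right _ _)
  · exact (mul_le_of_le_one_right h (by linarith [h0.1])).trans (le_max_left _ _)

/-- Agents other than `0` are promised nothing and receive `1 / 2`, so only agent `0` contributes;
its shortfall is never negative, so the truncation is inert. -/
lemma hardInstance_fairness_gap {p : Fin (l + 2) → ℝ} (hp : p ∈ stdSimplex ℝ (Fin (l + 2))) :
    let I := hardInstance k l σ δ hδ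
    ∑ i, max (I.C i * I.Astar i - I.reward i p) 0 = hardGap δ p := by
  intro I
  rw [Finset.sum_eq_single 0]
  · have := hardGap_nonneg (δ := δ) hp
    rw [hardInstance_C_zero, hardInstance_Astar_zero, hardInstance_reward_zero hδ hp]
    rw [hardGap] at *
    rw [max_eq_left (by linarith)]
    ring
  · intro i _ hi
    rw [hardInstance_C_of_ne hδ hi, hardInstance_reward_of_ne hδ hp hi]
    norm_num
  · simp

lemma exists_hardGap_eq_zero (l : ℕ) (δ : ℝ) :
    ∃ p ∈ stdSimplex ℝ (Fin (l + 2)), hardGap δ p = 0 := by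
  rcases le_total δ 0 with h | h
  · exact ⟨_, single_mem_stdSimplex ℝ 0, by simp [hardGap, h]⟩
  · exact ⟨_, single_mem_stdSimplex ℝ 1, by simp [hardGap, h]⟩

/-- Social welfare is a constant minus `hardGap`, and zero gap is exactly agent `0`'s fairness
constraint. -/
lemma hardInstance_isOptimalFair {p : Fin (l + 2) → ℝ} (hp : p ∈ stdSimplex ℝ (Fin (l + 2)))
    (h0 : hardGap δ p = 0) : (hardInstance k l σ δ hδ).IsOptimalFair p := by
  refine ⟨⟨hp, fun i => ?_⟩, fun q hq => ?_⟩
  · by_cases hi : i = 0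
    · subst hi
      rw [hardInstance_C_zero, hardInstance_Astar_zero, hardInstance_reward_zero hδ hp]
      rw [hardGap] at h0
      linarith
    · rw [hardInstance_C_of_ne hδ hi, hardInstance_reward_of_ne hδ hp hi]
      norm_num
  · rw [hardInstance_SW hδ hp, hardInstance_SW hδ hq.1]
    have := hardGap_nonneg (δ := δ) hq.1
    rw [hardGap] at *
    linarith

lemma hardInstance_fairnessRegret (π : Policy (k + 1) (l + 2)) (T : ℕ) :
    (hardInstance k l σ δ hδ).fairnessRegret π T =
      ∫ h : History (k + 1) (l + 2) T, ∑ t : Fin T, hardGap δ (Instance.roundPolicy π h t)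
        ∂((hardInstance k l σ δ hδ).historyLaw π T) := by
  refine integral_congr_ae (ae_of_all _ fun h => Finset.sum_congr rfl fun t _ => ?_)
  exact hardInstance_fairness_gap hδ (π.prob_mem _ _)

lemma hardInstance_swRegret {p : Fin (l + 2) → ℝ} (hp : p ∈ stdSimplex ℝ (Fin (l + 2)))
    (h0 : hardGap δ p = 0) (π : Policy (k + 1) (l + 2)) (T : ℕ) :
    (hardInstance k l σ δ hδ).swRegret p π T =
      ∫ h : History (k + 1) (l + 2) T, ∑ t : Fin T, hardGap δ (Instance.roundPolicy π h t)
        ∂((hardInstance k l σ δ hδ).historyLaw π T) := by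
  refine integral_congr_ae (ae_of_all _ fun h => ?_)
  have key : ∀ t, hardGap δ (Instance.roundPolicy π h t) =
      (hardInstance k l σ δ hδ).SW p -
        (hardInstance k l σ δ hδ).SW (Instance.roundPolicy π h t) := fun t => by
    rw [hardInstance_SW hδ hp, hardInstance_SW hδ (p := Instance.roundPolicy π h t)
      (π.prob_mem _ _)]
    rw [hardGap] at *
    linarith
  simp only [key]
  rw [Finset.sum_sub_distrib]
  simp

/-- Only agent `0`'s coordinate depends on `δ`; splitting it off leaves a common factor, so the
constant does not grow with the number of agents. -/
lemma sqDominated_rewardLaw_hardInstance {δ' : ℝ} (hδ' : |δ'| ≤ 1 / 4) (hσ : 0 < σ)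
    (j : Fin (l + 2)) :
    SqDominated ((hardInstance k l σ δ hδ).rewardLaw j) ((hardInstance k l σ δ' hδ').rewardLaw j)
      (ENNReal.ofReal (Real.exp ((δ - δ') ^ 2 / (σ : ℝ) ^ 2))) := by
  have hv : σ ^ 2 ≠ 0 := pow_ne_zero 2 hσ.ne'
  have h0 := SqDominated.gaussianReal (hardMean (k := k) δ 0 j) (hardMean (k := k) δ' 0 j) hv
  have hrest : (Measure.pi fun i : Fin k => (hardInstance k l σ δ hδ).D (Fin.succAbove 0 i) j) =
      Measure.pi fun i : Fin k => (hardInstance k l σ δ' hδ').D (Fin.succAbove 0 i) j := by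
    simp [hardInstance, hardMean]
  have : ∀ i j, IsProbabilityMeasure ((hardInstance k l σ δ hδ).D i j) := Instance.isProb _
  have : ∀ i j, IsProbabilityMeasure ((hardInstance k l σ δ' hδ').D i j) := Instance.isProb _
  have hprod := h0.prod
    (SqDominated.refl
      (Measure.pi fun i : Fin k => (hardInstance k l σ δ hδ).D (Fin.succAbove 0 i) j))
  refine (SqDominated.of_measurePreserving (MeasurableEquiv.piFinSuccAbove (fun _ => ℝ) 0)
    (measurePreserving_piFinSuccAbove (fun i => (hardInstance k l σ δ hδ).D i j) 0)
    (measurePreserving_piFinSuccAbove (fun i => (hardInstance k l σ δ' hδ').D i j) 0)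
    (hrest ▸ hprod)).mono ?_
  rw [mul_one]
  refine ENNReal.ofReal_le_ofReal (Real.exp_le_exp.2 ?_)
  push_cast
  gcongr ?_ / _
  simp only [hardMean]
  split_ifs
  · exact le_of_eq (by ring)
  · simpa using sq_nonneg (δ - δ')

end hardInstance

/-! ### The two-point argument -/

/-- The fraction of the rounds' probability mass which is put on arm `0`. -/
def zeroFraction {k l T : ℕ} (π : Policy (k + 1) (l + 2)) (h : History (k + 1) (l + 2) T) : ℝ :=
  (∑ t : Fin T, Instance.roundPolicy π h t 0) / T

section zeroFraction

variable {k l T : ℕ} (π : Policy (k + 1) (l + 2))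

lemma measurable_zeroFraction : Measurable (zeroFraction (T := T) π) := by
  refine (Finset.measurable_fun_sum _ fun t _ => ?_).div_const _
  refine (measurable_pi_apply 0).comp ((π.measurable_prob t).comp ?_)
  fun_prop

lemma zeroFraction_mem (h : History (k + 1) (l + 2) T) :
    zeroFraction π h ∈ Set.Icc (0 : ℝ) 1 := by
  have hp := fun t : Fin T => apply_mem_Icc (p := Instance.roundPolicy π h t) (π.prob_mem _ _) 0
  refine ⟨div_nonneg (Finset.sum_nonneg fun t _ => (hp t).1) T.cast_nonneg,
    div_le_one_of_le₀ ?_ T.cast_nonneg⟩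
  simpa using Finset.sum_le_card_nsmul Finset.univ _ 1 fun t _ => (hp t).2

lemma integral_sum_hardGap (μ : Measure (History (k + 1) (l + 2) T)) [IsProbabilityMeasure μ]
    (hT : 1 ≤ T) (δ : ℝ) :
    ∫ h, ∑ t : Fin T, hardGap δ (Instance.roundPolicy π h t) ∂μ =
      T * (max δ 0 - δ * (1 - ∫ h, zeroFraction π h ∂μ)) := by
  have hT' : (T : ℝ) ≠ 0 := by positivity
  have hint : Integrable (zeroFraction π) μ :=
    Integrable.of_mem_Icc 0 1 (measurable_zeroFraction π).aemeasurable
      (ae_of_all _ (zeroFraction_mem π))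
  have key : ∀ h : History (k + 1) (l + 2) T,
      ∑ t : Fin T, hardGap δ (Instance.roundPolicy π h t) =
        T * (max δ 0 - δ) + T * δ * zeroFraction π h := fun h => by
    simp only [hardGap, zeroFraction, Finset.sum_sub_distrib, ← Finset.mul_sum]
    simp
    field_simp
    ring
  simp only [key]
  rw [integral_add (integrable_const _) (hint.const_mul _)]
  simp [integral_const_mul]
  ring

end zeroFraction

/-- Every policy has regret of order `√T` on one of the hard instances with parameter `d`, `-d`,
where `d` is of order `1 / √T`. -/
lemma exists_hardInstance_regret_ge (hσ : 0 < σ) {k l T : ℕ} (hT : 1 ≤ T)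
    (π : Policy (k + 1) (l + 2)) :
    ∃ (δ : ℝ) (hδ : |δ| ≤ 1 / 4), min 1 (σ : ℝ) / 16 * √(T : ℝ) ≤
      ∫ h : History (k + 1) (l + 2) T, ∑ t : Fin T, hardGap δ (Instance.roundPolicy π h t)
        ∂((hardInstance k l σ δ hδ).historyLaw π T) := by
  have hσ' : (0 : ℝ) < σ := by exact_mod_cast hσ
  have hT1 : (1 : ℝ) ≤ T := by exact_mod_cast hT
  have hs1 : 1 ≤ √(T : ℝ) := Real.one_le_sqrt.2 hT1
  have hs0 : 0 < √(T : ℝ) := by linarith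
  have hss : √(T : ℝ) ^ 2 = T := Real.sq_sqrt (by linarith)
  set r := min 1 (σ : ℝ) with hr
  have hr0 : 0 < r := lt_min one_pos hσ'
  -- `r ≤ 1` keeps `d ≤ 1 / 4`, so the means stay in `(0, 1]`; `r ≤ σ` gives `T (2d)² / σ² ≤ 1 / 4 <
  -- log 2`.
  set d := r / (4 * √(T : ℝ)) with hd
  have hd0 : 0 < d := by positivity
  have hdT : T * d = r / 4 * √(T : ℝ) := by
    rw [hd]
    nth_rw 1 [← hss]
    field_simp
  have hd4 : |d| ≤ 1 / 4 := by
    rw [abs_of_pos hd0, hd, div_le_div_iff₀ (by positivity) (by norm_num)]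
    linarith [min_le_left 1 (σ : ℝ)]
  have hd4' : |-d| ≤ 1 / 4 := by rwa [abs_neg]
  have hdom : SqDominated ((hardInstance k l σ (-d) hd4').historyLaw π T)
      ((hardInstance k l σ d hd4).historyLaw π T) (ENNReal.ofReal 2) := by
    refine (Instance.sqDominated_historyLaw _ _ π
      (sqDominated_rewardLaw_hardInstance hd4' hd4 hσ) T).mono ?_
    rw [← ENNReal.ofReal_pow (Real.exp_nonneg _), ← Real.exp_nat_mul]
    refine ENNReal.ofReal_le_ofReal ?_
    have hle : (T : ℝ) * ((-d - d) ^ 2 / (σ : ℝ) ^ 2) ≤ Real.log 2 := by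
      have h1 : (T : ℝ) * ((-d - d) ^ 2 / (σ : ℝ) ^ 2) = (r / σ) ^ 2 / 4 := by
        rw [hd]
        nth_rw 1 [← hss]
        field_simp
        ring
      have h2 : (r / σ) ^ 2 ≤ 1 :=
        pow_le_one₀ (by positivity) ((div_le_one hσ').2 (min_le_right _ _))
      linarith [Real.log_two_gt_d9]
    exact (Real.exp_le_exp.2 hle).trans_eq (Real.exp_log two_pos)
  have hsq := hdom.sq_integral_le zero_le_two (measurable_zeroFraction π) (zeroFraction_mem π)
  set a := ∫ h, zeroFraction π h ∂((hardInstance k l σ d hd4).historyLaw π T)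
  set b := ∫ h, zeroFraction π h ∂((hardInstance k l σ (-d) hd4').historyLaw π T)
  -- Otherwise `b > 3 / 4` and `a < 1 / 4`, so `b² > 9 / 16 > 1 / 2 > 2a`, against `b² ≤ 2a`.
  have hab : 1 / 4 ≤ a ∨ 1 / 4 ≤ 1 - b := by
    by_contra! h
    nlinarith [sq_nonneg (b - 1)]
  rcases hab with h | h
  · refine ⟨d, hd4, ?_⟩
    rw [integral_sum_hardGap π _ hT, max_eq_left hd0.le]
    change _ ≤ (T : ℝ) * (d - d * (1 - a))
    calc r / 16 * √(T : ℝ) = T * d * (1 / 4) := by rw [hdT]; ring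
      _ ≤ T * d * a := by gcongr
      _ = _ := by ring
  · refine ⟨-d, hd4', ?_⟩
    rw [integral_sum_hardGap π _ hT, max_eq_right (by linarith)]
    change _ ≤ (T : ℝ) * (0 - -d * (1 - b))
    calc r / 16 * √(T : ℝ) = T * d * (1 / 4) := by rw [hdT]; ring
      _ ≤ T * d * (1 - b) := by gcongr
      _ = _ := by ring

end FairBandit

end

theorem theorem5 (σ : ℝ≥0) (hσ : 0 < σ) :
    ∃ c : ℝ, 0 < c ∧
      ∀ (n m : ℕ), 1 ≤ n → 2 ≤ m →
      ∀ (alg : FairBandit.Algorithm n m) (T : ℕ), 1 ≤ T →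
        (∃ I : FairBandit.Instance n m σ, I.FairnessCondition ∧
          ∃ pstar : Fin m → ℝ, I.IsOptimalFair pstar ∧
            c * √(T : ℝ) ≤ I.swRegret pstar (alg T I.C) T) ∧
        (∃ I : FairBandit.Instance n m σ, I.FairnessCondition ∧
          (∃ p : Fin m → ℝ, I.IsFair p) ∧
            c * √(T : ℝ) ≤ I.fairnessRegret (alg T I.C) T) := by
  refine ⟨min 1 (σ : ℝ) / 16, div_pos (lt_min one_pos (by exact_mod_cast hσ)) (by norm_num),
    fun n m hn hm alg T hT => ?_⟩
  obtain ⟨k, rfl⟩ := Nat.exists_eq_add_of_le' hn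
  obtain ⟨l, rfl⟩ := Nat.exists_eq_add_of_le' hm
  -- The fractions `C` do not depend on `δ`, so the algorithm's policy is fixed before `δ` is
  -- chosen. The resulting instance serves for both regrets.
  obtain ⟨δ, hδ, h⟩ :=
    FairBandit.exists_hardInstance_regret_ge hσ hT (alg T (Pi.single 0 1))
  obtain ⟨p, hp, hp0⟩ := FairBandit.exists_hardGap_eq_zero l δ
  have hopt := FairBandit.hardInstance_isOptimalFair (k := k) (σ := σ) hδ hp hp0
  have hfc := FairBandit.hardInstance_fairnessCondition (k := k) (l := l) (σ := σ) hδ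
  exact ⟨⟨_, hfc, p, hopt, h.trans_eq (FairBandit.hardInstance_swRegret hδ hp hp0 _ T).symm⟩,
    ⟨_, hfc, ⟨p, hopt.1⟩, h.trans_eq (FairBandit.hardInstance_fairnessRegret hδ _ T).symm⟩⟩
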